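/- Let $n\ge 6$ be even and let $\mathrm{Tr}$ be the absolute trace from $\mathrm{GF}(2^n)$ to $\mathrm{GF}(2)$. Let $f:\mathrm{GF}(2^n)\to\mathrm{GF}(2)$ be bent, that is, $\sum_{x\in\mathrm{GF}(2^n)}(-1)^{f(x)+\mathrm{Tr}(\mu x)}\in\{2^{n/2},-2^{n/2}\}$ for every $\mu\in\mathrm{GF}(2^n)$. Let $D_f=\{d_0,d_1,\dots,d_{\nu_f-1}\}$ be the support of $f$, where $\nu_f=\#D_f$ and the $d_i$ are pairwise different, and put $$\mathcal C(D_f)=\{(\mathrm{Tr}(xd_0)+y,\dots,\mathrm{Tr}(xd_{\nu_f-1})+y): x\in\mathrm{GF}(2^n),\ y\in\mathrm{GF}(2)\}.$$ Let $t_1,t_2$ be integers with $0\le t_1<t_2<\nu_f$, and let $\mathcal C(D_f)^{\{t_1,t_2\}}$ be the punctured code, obtained from $\mathcal C(D_f)$ by deleting the coordinates $t_1$ and $t_2$ from every codeword. Then $\mathcal C(D_f)^{\{t_1,t_2\}}$ is a binary linear code of length $\nu_f-2$ and dimension $n+1$. It is a seven-weight code (exactly seven different nonzero Hamming weights occur),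 and its weight distribution is the following, where the listed weights are pairwise different integers and no other weight occurs: $$\begin{array}{|c|c|}\hline \text{Weight}&\text{Number of codewords}\\\hline 0&1\\\hline \frac{\nu_f}{2}-2^{\frac{n-4}{2}}-2&\frac{(\nu_f-2^{\frac{n-2}{2}})(\nu_f-2^{\frac{n-2}{2}}-2)}{4\nu_f(\nu_f-1)}(2^n-1)\\\hline \frac{\nu_f}{2}-2^{\frac{n-4}{2}}-1&\frac{\nu_f^2-2^{n-2}}{2\nu_f(\nu_f-1)}(2^n-1)\\\hline \frac{\nu_f}{2}-2^{\frac{n-4}{2}}&\frac{(\nu_f+2^{\frac{n-2}{2}})(\nu_f+2^{\frac{n-2}{2}}-2)}{4\nu_f(\nu_f-1)}(2^n-1)\\\hline \frac{\nu_f}{2}+2^{\frac{n-4}{2}}-2&\frac{(\nu_f+2^{\frac{n-2}{2}})(\nu_f+2^{\frac{n-2}{2}}-2)}{4\nu_f(\nu_f-1)}(2^n-1)\\\hline \frac{\nu_f}{2}+2^{\frac{n-4}{2}}-1&\frac{\nu_f^2-2^{n-2}}{2\nu_f(\nu_f-1)}(2^n-1)\\\hline \frac{\nu_f}{2}+2^{\frac{n-4}{2}}&\frac{(\nu_f-2^{\frac{n-2}{2}})(\nu_f-2^{\frac{n-2}{2}}-2)}{4\nu_f(\nu_f-1)}(2^n-1)\\\hline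 \nu_f-2&1\\\hline \end{array}$$ -/

import Mathlib

namespace BentCode

section Codes

variable {K ι : Type*} [Field K]

/-- The code obtained from the linear code `C` (coordinate positions `ι`) by puncturing on the
set `T` of coordinate positions: every codeword is restricted to the positions outside `T`. -/
def puncture (C : Submodule K (ι → K)) (T : Finset ι) : Submodule K ({i : ι // i ∉ T} → K) :=
  C.map (LinearMap.funLeft K K (Subtype.val : {i : ι // i ∉ T} → ι))

variable [Fintype ι] [DecidableEq K]

/-- The length of a linear code: its number of coordinate positions. -/
def length (_C : Submodule K (ι → K)) : ℕ := Fintype.card ι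

/-- `weightCount C w` is the number `A_w(C)` of codewords of Hamming weight `w` in `C`. -/
noncomputable def weightCount (C : Submodule K (ι → K)) (w : ℕ) : ℕ :=
  {c : ι → K | c ∈ C ∧ hammingNorm c = w}.ncard

/-- The set of nonzero weights that occur in `C`. -/
def nonzeroWeights (C : Submodule K (ι → K)) : Set ℕ :=
  {w : ℕ | w ≠ 0 ∧ ∃ c ∈ C, hammingNorm c = w}

/-- `C` is an `s`-weight code: exactly `s` different nonzero weights occur in it. -/
def IsWeightCode (C : Submodule K (ι → K)) (s : ℕ) : Prop :=
  (nonzeroWeights C).ncard = s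

/-- `C` has the weight distribution given by a table of rows `(weight, multiplicity)`: the weights
of the rows are pairwise different natural numbers, the number of codewords of each of these
weights is the multiplicity of its row, and no other weight occurs. -/
def HasWeightDistribution (C : Submodule K (ι → K)) (table : List (ℚ × ℚ)) : Prop :=
  (table.map Prod.fst).Nodup ∧
  (∀ row ∈ table, ∃ w : ℕ, (w : ℚ) = row.1 ∧ (weightCount C w : ℚ) = row.2) ∧
  ∀ w : ℕ, (∀ row ∈ table, row.1 ≠ (w : ℚ)) → weightCount C w = 0

end Codes

section Bent

variable {F : Type*} [Field F] [Algebra (ZMod 2) F]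

/-- The Walsh transform `∑ x, (-1) ^ (f x + Tr (μ x))` of a Boolean function `f` on the finite
field `F` of characteristic two, where `Tr` is the absolute trace. -/
noncomputable def walsh [Fintype F] (f : F → ZMod 2) (μ : F) : ℤ :=
  ∑ x : F, (-1 : ℤ) ^ (f x + Algebra.trace (ZMod 2) F (μ * x)).val

/-- `f` is bent: all its Walsh coefficients are `± √|F|`, that is `± 2 ^ (n / 2)` if `F` has
`2 ^ n` elements. -/
def IsBent [Fintype F] (f : F → ZMod 2) : Prop :=
  ∀ μ : F, (walsh f μ : ℝ) = √(Fintype.card F : ℝ) ∨ (walsh f μ : ℝ) = -√(Fintype.card F : ℝ)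

/-- The binary linear code of all words `(Tr (x d₀) + y, …, Tr (x d_{ν-1}) + y)` with `x ∈ F` and
`y ∈ GF(2)`, where `d₀, …, d_{ν-1}` are given elements of `F`. -/
noncomputable def definingSetCode {ν : ℕ} (d : Fin ν → F) : Submodule (ZMod 2) (Fin ν → ZMod 2) where
  carrier := {c | ∃ (x : F) (y : ZMod 2), c = fun i => Algebra.trace (ZMod 2) F (x * d i) + y}
  zero_mem' := ⟨0, 0, by funext i; simp⟩
  add_mem' := by
    rintro _ _ ⟨x, y, rfl⟩ ⟨x', y', rfl⟩
    refine ⟨x + x', y + y', ?_⟩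
    funext i
    simp only [Pi.add_apply, add_mul, map_add]
    ring
  smul_mem' := by
    rintro a _ ⟨x, y, rfl⟩
    refine ⟨a • x, a * y, ?_⟩
    funext i
    simp only [Pi.smul_apply, smul_mul_assoc, map_smul, smul_eq_mul]
    ring

end Bent

end BentCode

namespace BentCode

/-! Write S(x) for the character sum of (-1)^Tr(xd) over d in the support of f. Since (-1)^f = 1 -
2·1_D, each Walsh coefficient at x ≠ 0 is -2S(x), so bentness says S(x) = ±2m with 16m² = 2^n; the
coefficient at 0 gives ν = 8m² ± 2m. With A, B the signs of Tr(xd) at the two deleted points, twice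
the punctured weight of (x, y) is ν - 2 - (-1)^y (S(x) - A - B) (`two_mul_weight_encode`). Hence x ≠
0 gives six possible weights, decided by three signs: e = (-1)^y S(x)/(2m), (-1)^y A and (-1)^y B.

To count a weight, expand its indicator as a polynomial in these signs (`card_weight_encode`).
Summing over y cancels the odd-degree terms. What remains needs only the sums over x of 1, AB, S·A
and S·B, all given by orthogonality of the trace characters. -/

/-- The sign `(-1) ^ z` of `z : ZMod 2`. -/
def sign (z : ZMod 2) : ℤ := (-1) ^ z.val

lemma sign_zero : sign 0 = 1 := rfl

lemma sign_one : sign 1 = -1 := rfl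

lemma sign_add : ∀ a b : ZMod 2, sign (a + b) = sign a * sign b := by decide

lemma sign_eq_one_or (a : ZMod 2) : sign a = 1 ∨ sign a = -1 := by
  revert a; decide

lemma one_sub_sign (a : ZMod 2) : 1 - sign a = 2 * if a ≠ 0 then 1 else 0 := by
  revert a; decide

/-- Twice the Hamming weight of a binary word is the sum of `1 - (-1) ^ cᵢ`. -/
lemma two_mul_hammingNorm {ι : Type*} [Fintype ι] (c : ι → ZMod 2) :
    2 * (hammingNorm c : ℤ) = ∑ i, (1 - sign (c i)) := by
  simp_rw [one_sub_sign, ← Finset.mul_sum, hammingNorm, Finset.sum_boole]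

/-! ### Trace characters and the Walsh transform -/

section Characters

variable {F : Type*} [Field F] [Algebra (ZMod 2) F]

local notation "tr" => Algebra.trace (ZMod 2) F

lemma exists_trace_mul_eq_one [Finite F] {a : F} (ha : a ≠ 0) : ∃ b : F, tr (b * a) = 1 := by
  by_contra! h
  apply ha
  have : FiniteDimensional (ZMod 2) F := Module.Finite.of_finite
  apply (traceForm_nondegenerate (ZMod 2) F).1 a
  intro b
  rw [Algebra.traceForm_apply, mul_comm]
  have : ∀ z : ZMod 2, z ≠ 1 → z = 0 := by decide
  exact this _ (h b)

lemma sum_sign_trace [Fintype F] [DecidableEq F] (a : F) :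
    ∑ x : F, sign (tr (x * a)) = if a = 0 then (Fintype.card F : ℤ) else 0 := by
  split_ifs with ha
  · simp [ha, sign_zero]
  · obtain ⟨b, hb⟩ := exists_trace_mul_eq_one ha
    -- Translation by b preserves the sum but negates every term, so the sum vanishes.
    have h := Equiv.sum_comp (Equiv.addRight b) fun x : F => sign (tr (x * a))
    simp only [Equiv.coe_addRight, add_mul, map_add, sign_add, hb, sign_one,
      ← Finset.sum_mul] at h
    linarith

/-- The character sum `∑ i, (-1) ^ Tr (x dᵢ)` over a family of elements of the field. -/
noncomputable def charSum {ν : ℕ} (d : Fin ν → F) (x : F) : ℤ := ∑ i, sign (tr (x * d i))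

lemma charSum_zero {ν : ℕ} (d : Fin ν → F) : charSum d 0 = ν := by
  simp [charSum, sign_zero]

lemma charSum_eq_sum_support [Fintype F] {ν : ℕ} {d : Fin ν → F} (hd : Function.Injective d)
    {f : F → ZMod 2} (hf : Set.range d = Function.support f) (x : F) :
    charSum d x = ∑ z : F, if f z ≠ 0 then sign (tr (x * z)) else 0 := by
  classical
  rw [← Finset.sum_filter, charSum,
    show Finset.univ.filter (fun z => f z ≠ 0) = Finset.univ.image d from ?_,
    Finset.sum_image fun _ _ _ _ h => hd h]
  ext z
  have : z ∈ Set.range d ↔ f z ≠ 0 := by rw [hf]; rfl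
  simpa using this.symm

lemma walsh_eq [Fintype F] {ν : ℕ} {d : Fin ν → F} (hd : Function.Injective d)
    {f : F → ZMod 2} (hf : Set.range d = Function.support f) (x : F) :
    walsh f x = ∑ z : F, sign (tr (x * z)) - 2 * charSum d x := by
  rw [charSum_eq_sum_support hd hf, Finset.mul_sum, ← Finset.sum_sub_distrib]
  refine Finset.sum_congr rfl fun z _ => ?_
  change sign _ = _
  rw [sign_add]
  have h := one_sub_sign (f z)
  split_ifs at h ⊢
  · rw [show sign (f z) = -1 by linarith]; ring
  · rw [show sign (f z) = 1 by linarith]; ring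

/-- In characteristic 2 the product of two characters is the character at d i + d p; after
exchanging sums, orthogonality leaves only i = p. -/
lemma sum_charSum_mul_sign [Fintype F] {ν : ℕ} {d : Fin ν → F} (hd : Function.Injective d)
    (p : Fin ν) : ∑ x : F, charSum d x * sign (tr (x * d p)) = Fintype.card F := by
  classical
  have : CharP F 2 := charP_of_injective_algebraMap (algebraMap (ZMod 2) F).injective 2
  simp_rw [charSum, Finset.sum_mul, ← sign_add, ← map_add, ← mul_add]
  rw [Finset.sum_comm]
  simp_rw [sum_sign_trace, CharTwo.add_eq_zero, hd.eq_iff]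
  simp

/-- The nontrivial character sums over the support of a bent function, and its size. -/
lemma IsBent.charSum [Fintype F] {f : F → ZMod 2} (hf : IsBent f) {ν : ℕ} {d : Fin ν → F}
    (hd : Function.Injective d) (hr : Set.range d = Function.support f) {s : ℕ}
    (hs : Fintype.card F = (2 * s) ^ 2) :
    ((ν : ℤ) = 2 * s ^ 2 + s ∨ (ν : ℤ) = 2 * s ^ 2 - s) ∧
      ∀ x, x ≠ 0 → charSum d x = s ∨ charSum d x = -s := by
  classical
  have hsq : √(Fintype.card F : ℝ) = 2 * s := by
    rw [hs]; push_cast; exact Real.sqrt_sq (by positivity)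
  have hw (x : F) : walsh f x = 2 * s ∨ walsh f x = -(2 * s) := by
    have := hf x
    rw [hsq] at this
    exact_mod_cast this
  have hsum (x : F) : walsh f x = (if x = 0 then (Fintype.card F : ℤ) else 0)
      - 2 * BentCode.charSum d x := by
    rw [walsh_eq hd hr, ← sum_sign_trace]
    simp_rw [mul_comm]
  refine ⟨?_, fun x hx => ?_⟩
  -- As S(0) = ν, the coefficient at 0 reads 4s² - 2ν = ±2s.
  · have h0 := hsum 0
    rw [if_pos rfl, charSum_zero, hs] at h0
    push_cast at h0
    rcases hw 0 with h | h <;> rw [h] at h0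
    · right; linarith
    · left; linarith
  · have h0 := hsum x
    rw [if_neg hx] at h0
    rcases hw x with h | h <;> rw [h] at h0
    · right; linarith
    · left; linarith

end Characters

/-! ### Weights of the punctured words and their counts -/

section Punctured

variable {F : Type*} [Field F] [Algebra (ZMod 2) F] {ν : ℕ}

local notation "tr" => Algebra.trace (ZMod 2) F

/-- The linear encoding `(x, y) ↦ (Tr (x dᵢ) + y)ᵢ` restricted to the positions outside `T`. -/
noncomputable def encode (d : Fin ν → F) (T : Finset (Fin ν)) :
    (F × ZMod 2) →ₗ[ZMod 2] ({i : Fin ν // i ∉ T} → ZMod 2) where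
  toFun z i := tr (z.1 * d i) + z.2
  map_add' z z' := by
    funext i
    simp only [Pi.add_apply, Prod.fst_add, Prod.snd_add, add_mul, map_add]
    ring
  map_smul' a z := by
    funext i
    simp only [Pi.smul_apply, Prod.smul_fst, Prod.smul_snd, smul_mul_assoc, map_smul,
      smul_eq_mul, RingHom.id_apply]
    ring

lemma range_encode (d : Fin ν → F) (T : Finset (Fin ν)) :
    LinearMap.range (encode d T) = puncture (definingSetCode d) T := by
  ext c
  constructor
  · rintro ⟨z, rfl⟩
    exact ⟨fun i => tr (z.1 * d i) + z.2, ⟨z.1, z.2, rfl⟩, rfl⟩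
  · rintro ⟨_, ⟨x, y, rfl⟩, rfl⟩
    exact ⟨(x, y), rfl⟩

/-- The sum of 1 - (-1)^c over all positions is ν - (-1)^y S(x); the terms at p and q are then
removed. -/
lemma two_mul_weight_encode (d : Fin ν → F) {p q : Fin ν} (hpq : p ≠ q) (x : F) (y : ZMod 2) :
    2 * (hammingNorm (encode d {p, q} (x, y)) : ℤ) =
      ν - 2 - sign y * charSum d x + sign y * sign (tr (x * d p))
        + sign y * sign (tr (x * d q)) := by
  have h := Finset.sum_compl_add_sum ({p, q} : Finset (Fin ν))
    fun i => 1 - sign y * sign (tr (x * d i))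
  rw [Finset.sum_pair hpq, Finset.sum_subtype (p := fun i => i ∉ ({p, q} : Finset (Fin ν))) _
    (fun i => Finset.mem_compl), Finset.sum_sub_distrib (s := Finset.univ (α := Fin ν)),
    ← Finset.mul_sum, Finset.sum_const, Finset.card_univ, Fintype.card_fin, nsmul_one] at h
  rw [two_mul_hammingNorm]
  simp only [encode, LinearMap.coe_mk, AddHom.coe_mk, sign_add, mul_comm _ (sign y)]
  change _ + _ = (ν : ℤ) - sign y * charSum d x at h
  linarith

lemma sum_zmod_two {M : Type*} [AddCommMonoid M] (g : ZMod 2 → M) : ∑ y, g y = g 0 + g 1 :=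
  Fin.sum_univ_two g

/-- The weights of the punctured words. -/
lemma weight_encode_cases {d : Fin ν → F} {p q : Fin ν} {m h : ℕ} (hpq : p ≠ q)
    (hν : ν = 2 * h)
    (hS : ∀ x, x ≠ 0 → charSum d x = 2 * m ∨ charSum d x = -(2 * m)) (z : F × ZMod 2) :
    z = 0 ∨ (z = (0, 1) ∧ hammingNorm (encode d {p, q} z) + 2 = 2 * h) ∨
      (z.1 ≠ 0 ∧ ((hammingNorm (encode d {p, q} z) + m + 2 = h ∨
        hammingNorm (encode d {p, q} z) + m + 1 = h ∨ hammingNorm (encode d {p, q} z) + m = h) ∨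
        (hammingNorm (encode d {p, q} z) + 2 = h + m ∨
        hammingNorm (encode d {p, q} z) + 1 = h + m ∨
        hammingNorm (encode d {p, q} z) = h + m))) := by
  obtain ⟨x, y⟩ := z
  have hW := two_mul_weight_encode d hpq x y
  by_cases hx : x = 0
  · subst hx
    rcases (by decide : ∀ y : ZMod 2, y = 0 ∨ y = 1) y with rfl | rfl
    · exact Or.inl rfl
    · refine Or.inr (Or.inl ⟨rfl, ?_⟩)
      simp only [charSum_zero, zero_mul, map_zero, sign_zero, sign_one] at hW
      omega
  · refine Or.inr (Or.inr ⟨hx, ?_⟩)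
    rcases hS x hx with h | h <;> rcases sign_eq_one_or y with h' | h' <;>
    rcases sign_eq_one_or (tr (x * d p)) with hA | hA <;>
    rcases sign_eq_one_or (tr (x * d q)) with hB | hB <;>
    rw [h, h', hA, hB] at hW <;> omega

variable [Fintype F]

lemma weightCount_eq_card {d : Fin ν → F} {T : Finset (Fin ν)}
    (hinj : Function.Injective (encode d T)) (w : ℕ) :
    weightCount (puncture (definingSetCode d) T) w =
      (Finset.univ.filter fun z => hammingNorm (encode d T z) = w).card := by
  rw [weightCount, ← Set.ncard_coe_finset, ← Set.ncard_image_of_injective _ hinj,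
    ← range_encode]
  congr 1
  ext c
  simp only [Set.mem_ofPred_eq, LinearMap.mem_range, Finset.coe_filter, Finset.mem_univ, true_and,
    Set.mem_image]
  constructor
  · rintro ⟨⟨z, rfl⟩, h⟩
    exact ⟨z, h, rfl⟩
  · rintro ⟨z, h, rfl⟩
    exact ⟨⟨z, rfl⟩, h⟩

variable {d : Fin ν → F} {p q : Fin ν} {m h : ℕ}

/-- The number of pairs `(x, y)` with `x ≠ 0` for which the sign of the character sum and the
two deleted coordinates satisfy a condition with the given indicator polynomial. -/
lemma card_weight_encode (hd : Function.Injective d) (hpq : p ≠ q)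
    (hF : Fintype.card F = 16 * m ^ 2) (hν : ν = 2 * h)
    (hS : ∀ x, x ≠ 0 → charSum d x = 2 * m ∨ charSum d x = -(2 * m))
    {w : ℕ} (hw0 : w ≠ 0) (hw1 : w + 2 ≠ ν) (e₀ a b c : ℤ)
    (hind : ∀ e A B : ℤ, (e = 1 ∨ e = -1) → (A = 1 ∨ A = -1) → (B = 1 ∨ B = -1) →
      (1 + e₀ * e) * (a + b * (A + B) + c * (A * B)) =
        if (2 * w : ℤ) = 2 * h - 2 - 2 * m * e + A + B then 8 else 0) :
    8 * m * ((Finset.univ.filter fun z => hammingNorm (encode d {p, q} z) = w).card : ℤ) =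
      2 * (a * m * (16 * m ^ 2 - 1) + b * e₀ * (16 * m ^ 2 - 2 * h) - c * m) := by
  classical
  have : CharP F 2 := charP_of_injective_algebraMap (algebraMap (ZMod 2) F).injective 2
  -- The factor 8 is the value of the indicator polynomial on its support, which keeps its
  -- coefficients integral.
  have hcount : 8 * ((Finset.univ.filter fun z => hammingNorm (encode d {p, q} z) = w).card : ℤ)
      = ∑ x : F, ∑ y : ZMod 2,
        if hammingNorm (encode d {p, q} (x, y)) = w then (8 : ℤ) else 0 := by
    rw [← Fintype.sum_prod_type', ← Finset.sum_filter, Finset.sum_const, nsmul_eq_mul, mul_comm]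
  -- At x = 0 the weights are 0 and ν - 2, both excluded by `hw0` and `hw1`.
  have hx0 : ∑ y : ZMod 2, (if hammingNorm (encode d {p, q} (0, y)) = w then (8 : ℤ) else 0)
      = 0 := by
    have h0 := two_mul_weight_encode d hpq 0 0
    have h1 := two_mul_weight_encode d hpq 0 1
    simp only [charSum_zero, zero_mul, map_zero, sign_zero, sign_one] at h0 h1
    rw [sum_zmod_two, if_neg (by omega), if_neg (by omega), add_zero]
  -- Multiplying by m allows m·e to be replaced by S(x)/2 without division.
  have hx (x : F) (hx : x ∈ Finset.univ.erase 0) :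
      m * ∑ y : ZMod 2, (if hammingNorm (encode d {p, q} (x, y)) = w then (8 : ℤ) else 0) =
      2 * a * m + 2 * c * m * sign (tr (x * (d p + d q))) + b * e₀ *
        (charSum d x * sign (tr (x * d p)) + charSum d x * sign (tr (x * d q))) := by
    have hA := sign_eq_one_or (tr (x * d p))
    have hB := sign_eq_one_or (tr (x * d q))
    have hWy := two_mul_weight_encode d hpq x
    rw [mul_add, map_add, sign_add]
    generalize sign (tr (x * d p)) = A at *
    generalize sign (tr (x * d q)) = B at *
    obtain ⟨e, he, hSe⟩ : ∃ e : ℤ, (e = 1 ∨ e = -1) ∧ charSum d x = 2 * m * e := by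
      rcases hS x (Finset.ne_of_mem_erase hx) with h | h
      · exact ⟨1, Or.inl rfl, by linarith⟩
      · exact ⟨-1, Or.inr rfl, by linarith⟩
    rw [hSe] at hWy ⊢
    have hW0 := hWy 0
    have hW1 := hWy 1
    rw [sign_zero] at hW0
    rw [sign_one] at hW1
    have hc0 := hind e A B he hA hB
    -- Passing from y = 0 to y = 1 flips all three signs, so adding the two indicators keeps only
    -- the even-degree terms.
    have hc1 := hind (-e) (-A) (-B) (by omega) (by omega) (by omega)
    have i0 : hammingNorm (encode d {p, q} (x, 0)) = w ↔
        (2 * w : ℤ) = 2 * h - 2 - 2 * m * e + A + B := by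
      rw [← Nat.cast_inj (R := ℤ)]; subst hν; push_cast at hW0
      constructor <;> intro <;> linarith
    have i1 : hammingNorm (encode d {p, q} (x, 1)) = w ↔
        (2 * w : ℤ) = 2 * h - 2 - 2 * m * -e + -A + -B := by
      rw [← Nat.cast_inj (R := ℤ)]; subst hν; push_cast at hW1
      constructor <;> intro <;> linarith
    rw [sum_zmod_two]
    simp only [i0, i1]
    rw [← hc0, ← hc1]
    ring
  -- Each full sum over F is known by orthogonality; subtracting its x = 0 term (ν, ν and 1) gives
  -- the sum over x ≠ 0.
  have hP := sum_charSum_mul_sign hd p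
  have hQ := sum_charSum_mul_sign hd q
  have hPQ := sum_sign_trace (F := F) (d p + d q)
  rw [if_neg (by rw [CharTwo.add_eq_zero]; exact hd.ne hpq),
    ← Finset.add_sum_erase _ _ (Finset.mem_univ 0)] at hPQ
  rw [← Finset.add_sum_erase _ _ (Finset.mem_univ 0)] at hP hQ
  simp only [charSum_zero, zero_mul, map_zero, sign_zero, hF, hν] at hP hQ hPQ
  push_cast at hP hQ
  rw [mul_comm (8 : ℤ), mul_assoc, hcount, ← Finset.add_sum_erase _ _ (Finset.mem_univ 0), hx0,
    zero_add, Finset.mul_sum, Finset.sum_congr rfl hx, Finset.sum_add_distrib,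
    Finset.sum_add_distrib, ← Finset.mul_sum _ _ (b * e₀), ← Finset.mul_sum _ _ (2 * c * (m : ℤ)),
    Finset.sum_add_distrib, Finset.sum_const, Finset.card_erase_of_mem (Finset.mem_univ _), Finset.card_univ, hF,
    nsmul_eq_mul, eq_sub_of_add_eq' hP, eq_sub_of_add_eq' hQ, eq_sub_of_add_eq' hPQ,
    Nat.cast_sub (by rw [← hF]; exact Fintype.card_pos)]
  push_cast
  ring

end Punctured

/-! ### The weight distribution, with least nonzero weight g = ν/2 - m - 2 -/

section Table

variable {F : Type*} [Field F] [Algebra (ZMod 2) F] {ν : ℕ} {d : Fin ν → F}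
  {p q : Fin ν} {m g : ℕ}

/-- Every nonzero pair has positive weight, because g > 0 and the top weight ν - 2 is positive. -/
lemma encode_injective (hpq : p ≠ q) (hν : ν = 2 * (g + m + 2)) (hg : 0 < g)
    (hS : ∀ x, x ≠ 0 → charSum d x = 2 * m ∨ charSum d x = -(2 * m)) :
    Function.Injective (encode d {p, q}) := by
  rw [injective_iff_map_eq_zero]
  intro z hz
  have h0 : hammingNorm (encode d {p, q} z) = 0 := by rw [hz, hammingNorm_zero]
  rcases weight_encode_cases hpq hν hS z with h | h | h
  · exact h
  · omega
  · omega

variable [Fintype F]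

lemma weightCount_zero (hpq : p ≠ q) (hν : ν = 2 * (g + m + 2)) (hg : 0 < g)
    (hS : ∀ x, x ≠ 0 → charSum d x = 2 * m ∨ charSum d x = -(2 * m)) :
    weightCount (puncture (definingSetCode d) {p, q}) 0 = 1 := by
  classical
  rw [weightCount_eq_card (encode_injective hpq hν hg hS), Finset.card_eq_one]
  refine ⟨0, ?_⟩
  ext z
  simp only [Finset.mem_filter_univ, hammingNorm_eq_zero, Finset.mem_singleton]
  exact map_eq_zero_iff _ (encode_injective hpq hν hg hS)

lemma weightCount_top (hpq : p ≠ q) (hν : ν = 2 * (g + m + 2)) (hg : 0 < g)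
    (hS : ∀ x, x ≠ 0 → charSum d x = 2 * m ∨ charSum d x = -(2 * m)) :
    weightCount (puncture (definingSetCode d) {p, q}) (2 * g + 2 * m + 2) = 1 := by
  classical
  rw [weightCount_eq_card (encode_injective hpq hν hg hS), Finset.card_eq_one]
  refine ⟨(0, 1), ?_⟩
  ext z
  simp only [Finset.mem_filter_univ, Finset.mem_singleton]
  constructor
  · intro hz
    rcases weight_encode_cases hpq hν hS z with rfl | h | h
    · rw [map_zero, hammingNorm_zero] at hz; omega
    · exact h.1
    · omega
  · rintro rfl
    rcases weight_encode_cases hpq hν hS (0, 1) with h | h | h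
    · simp at h
    · omega
    · exact absurd rfl h.1

lemma weightCount_eq_zero (hpq : p ≠ q) (hν : ν = 2 * (g + m + 2)) (hg : 0 < g)
    (hS : ∀ x, x ≠ 0 → charSum d x = 2 * m ∨ charSum d x = -(2 * m)) {w : ℕ}
    (hw : w ∉ [0, g, g + 1, g + 2, g + 2 * m, g + 2 * m + 1, g + 2 * m + 2,
      2 * g + 2 * m + 2]) :
    weightCount (puncture (definingSetCode d) {p, q}) w = 0 := by
  rw [weightCount_eq_card (encode_injective hpq hν hg hS), Finset.card_eq_zero,
    Finset.filter_eq_empty_iff]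
  intro z _ hz
  simp only [List.mem_cons, List.not_mem_nil, or_false, not_or] at hw
  rcases weight_encode_cases hpq hν hS z with rfl | h | h
  · rw [map_zero, hammingNorm_zero] at hz; omega
  · omega
  · omega

/-- The number of words of a weight, in terms of the indicator polynomial of the weight. -/
lemma two_mul_weightCount (hd : Function.Injective d) (hpq : p ≠ q)
    (hF : Fintype.card F = 16 * m ^ 2) (hν : ν = 2 * (g + m + 2)) (hg : 0 < g) (hm : 2 ≤ m)
    (hS : ∀ x, x ≠ 0 → charSum d x = 2 * m ∨ charSum d x = -(2 * m)) {δ : ℤ}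
    (hδ : (g + m + 2 : ℤ) = 4 * m ^ 2 + δ * m) {w : ℕ} (hw0 : w ≠ 0) (hw1 : w + 2 ≠ ν)
    (e₀ a b c : ℤ)
    (hind : ∀ e A B : ℤ, (e = 1 ∨ e = -1) → (A = 1 ∨ A = -1) → (B = 1 ∨ B = -1) →
      (1 + e₀ * e) * (a + b * (A + B) + c * (A * B)) =
        if (w : ℤ) * 2 = 2 * (g + m + 2) - 2 - 2 * m * e + A + B then 8 else 0) :
    4 * (weightCount (puncture (definingSetCode d) {p, q}) w : ℤ) =
      a * (16 * m ^ 2 - 1) + b * e₀ * (8 * m - 2 * δ) - c := by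
  rw [weightCount_eq_card (encode_injective hpq hν hg hS)]
  have key := card_weight_encode hd hpq hF hν hS hw0 hw1 e₀ a b c (by
    intro e A B he hA hB
    rw [hind e A B he hA hB]
    push_cast
    rw [mul_comm (w : ℤ)])
  have hm0 : (2 * m : ℤ) ≠ 0 := by positivity
  push_cast at key
  -- Here 16m² - ν = m(8m - 2δ), so a factor 2m cancels throughout.
  rw [hδ] at key
  apply mul_left_cancel₀ hm0
  linear_combination key

/-- The weight distribution of the punctured code, indexed by natural numbers. -/
lemma weightCounts (hd : Function.Injective d) (hpq : p ≠ q)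
    (hF : Fintype.card F = 16 * m ^ 2) (hν : ν = 2 * (g + m + 2)) (hg : 0 < g) (hm : 2 ≤ m)
    (hS : ∀ x, x ≠ 0 → charSum d x = 2 * m ∨ charSum d x = -(2 * m)) {δ : ℤ}
    (hδ : (g + m + 2 : ℤ) = 4 * m ^ 2 + δ * m) :
    2 * (weightCount (puncture (definingSetCode d) {p, q}) g : ℤ) =
      8 * m ^ 2 - 1 - (4 * m - δ) ∧
    (weightCount (puncture (definingSetCode d) {p, q}) (g + 1) : ℤ) = 8 * m ^ 2 ∧
    2 * (weightCount (puncture (definingSetCode d) {p, q}) (g + 2) : ℤ) =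
      8 * m ^ 2 - 1 + (4 * m - δ) ∧
    2 * (weightCount (puncture (definingSetCode d) {p, q}) (g + 2 * m) : ℤ) =
      8 * m ^ 2 - 1 + (4 * m - δ) ∧
    (weightCount (puncture (definingSetCode d) {p, q}) (g + 2 * m + 1) : ℤ) = 8 * m ^ 2 ∧
    2 * (weightCount (puncture (definingSetCode d) {p, q}) (g + 2 * m + 2) : ℤ) =
      8 * m ^ 2 - 1 - (4 * m - δ) := by
  have H := fun {w : ℕ} => two_mul_weightCount (w := w) hd hpq hF hν hg hm hS hδ
  refine ⟨?_, ?_, ?_, ?_, ?_, ?_⟩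
  -- The indicators are (1 ± e) times (1-A)(1-B), 2 - 2AB or (1+A)(1+B), according to A + B = -2, 0
  -- or 2; the sign before e selects the lower or upper triple of weights.
  · have := H (w := g) (by omega) (by omega) 1 1 (-1) 1 (by
      rintro e A B (rfl | rfl) (rfl | rfl) (rfl | rfl) <;> split_ifs <;> omega)
    linarith
  · have := H (w := g + 1) (by omega) (by omega) 1 2 0 (-2) (by
      rintro e A B (rfl | rfl) (rfl | rfl) (rfl | rfl) <;> split_ifs <;> omega)
    linarith
  · have := H (w := g + 2) (by omega) (by omega) 1 1 1 1 (by
      rintro e A B (rfl | rfl) (rfl | rfl) (rfl | rfl) <;> split_ifs <;> omega)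
    linarith
  · have := H (w := g + 2 * m) (by omega) (by omega) (-1) 1 (-1) 1 (by
      rintro e A B (rfl | rfl) (rfl | rfl) (rfl | rfl) <;> split_ifs <;> omega)
    linarith
  · have := H (w := g + 2 * m + 1) (by omega) (by omega) (-1) 2 0 (-2) (by
      rintro e A B (rfl | rfl) (rfl | rfl) (rfl | rfl) <;> split_ifs <;> omega)
    linarith
  · have := H (w := g + 2 * m + 2) (by omega) (by omega) (-1) 1 1 1 (by
      rintro e A B (rfl | rfl) (rfl | rfl) (rfl | rfl) <;> split_ifs <;> omega)
    linarith

lemma mem_nonzeroWeights_iff {ι : Type*} [Fintype ι] (C : Submodule (ZMod 2) (ι → ZMod 2))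
    (w : ℕ) : w ∈ nonzeroWeights C ↔ w ≠ 0 ∧ weightCount C w ≠ 0 := by
  rw [weightCount, ← Nat.pos_iff_ne_zero (n := Set.ncard _), Set.ncard_pos]
  rfl

/-- Nonzero multiplicities make every listed weight occur, the last clause of the distribution
excludes others, and distinctness keeps 0 out of the remaining rows; so the nonzero weights are
counted by the rows. -/
lemma HasWeightDistribution.isWeightCode {ι : Type*} [Fintype ι]
    {C : Submodule (ZMod 2) (ι → ZMod 2)} {a : ℚ} {table : List (ℚ × ℚ)}
    (h : HasWeightDistribution C ((0, a) :: table)) (hpos : ∀ row ∈ table, row.2 ≠ 0) :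
    IsWeightCode C table.length := by
  classical
  obtain ⟨hnodup, hrow, hother⟩ := h
  rw [List.map_cons, List.nodup_cons] at hnodup
  have himage : (Nat.cast : ℕ → ℚ) '' nonzeroWeights C = ((table.map Prod.fst).toFinset : Set ℚ) := by
    ext r
    simp only [Set.mem_image, mem_nonzeroWeights_iff, List.coe_toFinset, Set.mem_ofPred_eq,
      List.mem_map]
    constructor
    · rintro ⟨w, ⟨hw0, hw⟩, rfl⟩
      by_contra! hne
      refine hw (hother w fun row hr => ?_)
      rcases List.mem_cons.1 hr with rfl | hr
      · exact Nat.cast_ne_zero.2 hw0 |>.symm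
      · exact hne row hr
    · rintro ⟨row, hr, rfl⟩
      obtain ⟨w, hw, hc⟩ := hrow row (List.mem_cons_of_mem _ hr)
      refine ⟨w, ⟨?_, ?_⟩, hw⟩
      · rintro rfl
        exact hnodup.1 (List.mem_map.2 ⟨row, hr, by simpa using hw.symm⟩)
      · intro h0
        exact hpos row hr (by rw [← hc, h0, Nat.cast_zero])
  rw [IsWeightCode, ← Set.ncard_image_of_injective _ (Nat.cast_injective (R := ℚ)), himage,
    Set.ncard_coe_finset, List.toFinset_card_of_nodup hnodup.2, List.length_map]

lemma finrank_puncture (hpq : p ≠ q) (hν : ν = 2 * (g + m + 2)) (hg : 0 < g)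
    (hS : ∀ x, x ≠ 0 → charSum d x = 2 * m ∨ charSum d x = -(2 * m)) {n : ℕ}
    (hF : Fintype.card F = 2 ^ n) :
    Module.finrank (ZMod 2) (puncture (definingSetCode d) {p, q}) = n + 1 := by
  have hn : Module.finrank (ZMod 2) F = n := by
    have h := Module.card_eq_pow_finrank (K := ZMod 2) (V := F)
    rw [hF, ZMod.card] at h
    exact (Nat.pow_right_injective le_rfl h).symm
  rw [← range_encode, LinearMap.finrank_range_of_inj (encode_injective hpq hν hg hS),
    Module.finrank_prod, hn, Module.finrank_self]

lemma length_puncture {K : Type*} [Field K] (C : Submodule K (Fin ν → K)) (hpq : p ≠ q) :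
    length (puncture C {p, q}) = ν - 2 := by
  rw [length, Fintype.card_subtype_compl, Fintype.card_fin, Fintype.card_coe,
    Finset.card_pair hpq]

/-- The weight distribution of the punctured code, with `2 ^ n = 16 m ^ 2`. -/
lemma hasWeightDistribution_puncture (hd : Function.Injective d) (hpq : p ≠ q)
    (hF : Fintype.card F = 16 * m ^ 2) (hν : ν = 2 * (g + m + 2)) (hg : 0 < g) (hm : 2 ≤ m)
    (hS : ∀ x, x ≠ 0 → charSum d x = 2 * m ∨ charSum d x = -(2 * m)) {δ : ℤ}
    (hδ : (g + m + 2 : ℤ) = 4 * m ^ 2 + δ * m) :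
    HasWeightDistribution (puncture (definingSetCode d) {p, q})
      [(0, 1), ((g : ℚ), (8 * m ^ 2 - 1 - (4 * m - δ)) / 2), ((g : ℚ) + 1, 8 * m ^ 2),
        ((g : ℚ) + 2, (8 * m ^ 2 - 1 + (4 * m - δ)) / 2),
        ((g : ℚ) + 2 * m, (8 * m ^ 2 - 1 + (4 * m - δ)) / 2),
        ((g : ℚ) + 2 * m + 1, 8 * m ^ 2),
        ((g : ℚ) + 2 * m + 2, (8 * m ^ 2 - 1 - (4 * m - δ)) / 2),
        (2 * (g : ℚ) + 2 * m + 2, 1)] := by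
  refine ⟨?_, ?_, ?_⟩
  · have : ([0, g, g + 1, g + 2, g + 2 * m, g + 2 * m + 1, g + 2 * m + 2,
        2 * g + 2 * m + 2] : List ℕ).Nodup := by
      simp only [List.nodup_cons, List.mem_cons, List.not_mem_nil, or_false, not_or,
        List.nodup_nil, not_false_eq_true, and_true]
      omega
    simpa using this.map (Nat.cast_injective (R := ℚ))
  · obtain ⟨h1, h2, h3, h4, h5, h6⟩ := weightCounts hd hpq hF hν hg hm hS hδ
    have h0 := weightCount_zero hpq hν hg hS
    have h7 := weightCount_top hpq hν hg hS
    simp only [List.forall_mem_cons]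
    refine ⟨⟨0, by simp, by simp [h0]⟩, ⟨g, rfl, ?_⟩, ⟨g + 1, by push_cast; rfl, ?_⟩,
      ⟨g + 2, by push_cast; rfl, ?_⟩, ⟨g + 2 * m, by push_cast; rfl, ?_⟩,
      ⟨g + 2 * m + 1, by push_cast; rfl, ?_⟩, ⟨g + 2 * m + 2, by push_cast; rfl, ?_⟩,
      ⟨2 * g + 2 * m + 2, by push_cast; rfl, by simp [h7]⟩, by simp⟩
    · rw [eq_div_iff two_ne_zero, mul_comm]; exact_mod_cast h1
    · exact_mod_cast h2
    · rw [eq_div_iff two_ne_zero, mul_comm]; exact_mod_cast h3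
    · rw [eq_div_iff two_ne_zero, mul_comm]; exact_mod_cast h4
    · exact_mod_cast h5
    · rw [eq_div_iff two_ne_zero, mul_comm]; exact_mod_cast h6
  · intro w hw
    apply weightCount_eq_zero hpq hν hg hS
    intro hmem
    simp only [List.forall_mem_cons] at hw
    simp only [List.mem_cons, List.not_mem_nil, or_false] at hmem
    obtain ⟨h0, h1, h2, h3, h4, h5, h6, h7, -⟩ := hw
    rcases hmem with rfl | rfl | rfl | rfl | rfl | rfl | rfl | rfl <;> push_cast at * <;>
      contradiction

end Table

end BentCode

/-! ### Translation to the parameters n and ν -/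

theorem mainTheorem10 {F : Type*} [Field F] [Fintype F] [Algebra (ZMod 2) F]
    (n : ℕ) (hn : 6 ≤ n) (hn_even : Even n) (hF : Fintype.card F = 2 ^ n)
    (f : F → ZMod 2) (hf : BentCode.IsBent f)
    (ν : ℕ) (d : Fin ν → F) (hd_inj : Function.Injective d)
    (hd_range : Set.range d = Function.support f)
    (t₁ t₂ : Fin ν) (ht : t₁ < t₂) :
    BentCode.length (BentCode.puncture (BentCode.definingSetCode d) {t₁, t₂}) = ν - 2 ∧
    Module.finrank (ZMod 2) (BentCode.puncture (BentCode.definingSetCode d) {t₁, t₂}) = n + 1 ∧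
    BentCode.IsWeightCode (BentCode.puncture (BentCode.definingSetCode d) {t₁, t₂}) 7 ∧
    BentCode.HasWeightDistribution (BentCode.puncture (BentCode.definingSetCode d) {t₁, t₂})
      [ (0, 1),
        ((ν : ℚ) / 2 - 2 ^ ((n - 4) / 2) - 2,
          ((ν : ℚ) - 2 ^ ((n - 2) / 2)) * ((ν : ℚ) - 2 ^ ((n - 2) / 2) - 2)
            / (4 * (ν : ℚ) * ((ν : ℚ) - 1)) * (2 ^ n - 1)),
        ((ν : ℚ) / 2 - 2 ^ ((n - 4) / 2) - 1,
          ((ν : ℚ) ^ 2 - 2 ^ (n - 2)) / (2 * (ν : ℚ) * ((ν : ℚ) - 1)) * (2 ^ n - 1)),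
        ((ν : ℚ) / 2 - 2 ^ ((n - 4) / 2),
          ((ν : ℚ) + 2 ^ ((n - 2) / 2)) * ((ν : ℚ) + 2 ^ ((n - 2) / 2) - 2)
            / (4 * (ν : ℚ) * ((ν : ℚ) - 1)) * (2 ^ n - 1)),
        ((ν : ℚ) / 2 + 2 ^ ((n - 4) / 2) - 2,
          ((ν : ℚ) + 2 ^ ((n - 2) / 2)) * ((ν : ℚ) + 2 ^ ((n - 2) / 2) - 2)
            / (4 * (ν : ℚ) * ((ν : ℚ) - 1)) * (2 ^ n - 1)),
        ((ν : ℚ) / 2 + 2 ^ ((n - 4) / 2) - 1,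
          ((ν : ℚ) ^ 2 - 2 ^ (n - 2)) / (2 * (ν : ℚ) * ((ν : ℚ) - 1)) * (2 ^ n - 1)),
        ((ν : ℚ) / 2 + 2 ^ ((n - 4) / 2),
          ((ν : ℚ) - 2 ^ ((n - 2) / 2)) * ((ν : ℚ) - 2 ^ ((n - 2) / 2) - 2)
            / (4 * (ν : ℚ) * ((ν : ℚ) - 1)) * (2 ^ n - 1)),
        ((ν : ℚ) - 2, 1) ] := by
  -- With n = 2(k + 2), m = 2^k is the 2^((n-4)/2) of the table; n ≥ 6 gives m ≥ 2.
  obtain ⟨k, rfl⟩ : ∃ k, n = 2 * (k + 2) := by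
    obtain ⟨r, hr⟩ := hn_even
    exact ⟨r - 2, by omega⟩
  set m := 2 ^ k with hm_def
  have hm : 2 ≤ m := Nat.le_self_pow (by omega) 2
  have hF' : Fintype.card F = 16 * m ^ 2 := by rw [hF, hm_def]; ring
  obtain ⟨hν, hS⟩ := hf.charSum hd_inj hd_range (s := 2 * m) (by rw [hF']; ring)
  push_cast at hν hS
  have hpq := ht.ne
  obtain ⟨δ, hδ, hνδ⟩ : ∃ δ : ℤ, (δ = 1 ∨ δ = -1) ∧ (ν : ℤ) = 2 * (4 * m ^ 2 + δ * m) := by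
    rcases hν with h | h
    · exact ⟨1, Or.inl rfl, by linarith⟩
    · exact ⟨-1, Or.inr rfl, by linarith⟩
  have hmZ : (2 : ℤ) ≤ m := by exact_mod_cast hm
  -- This makes g positive; it would fail for m = 1, δ = -1.
  have hbig : (m : ℤ) + 2 < 4 * m ^ 2 + δ * m := by
    rcases hδ with rfl | rfl <;> nlinarith
  obtain ⟨g, hg, hgδ⟩ : ∃ g : ℕ, 0 < g ∧ (g + m + 2 : ℤ) = 4 * m ^ 2 + δ * m :=
    ⟨(4 * m ^ 2 + δ * m - m - 2 : ℤ).toNat, by omega, by omega⟩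
  have hνg : ν = 2 * (g + m + 2) := by omega
  have hdist := BentCode.hasWeightDistribution_puncture hd_inj hpq hF' hνg hg hm hS hgδ
  refine ⟨BentCode.length_puncture _ hpq, BentCode.finrank_puncture hpq hνg hg hS hF,
    hdist.isWeightCode ?_, ?_⟩
  · have hmQ : (2 : ℚ) ≤ m := by exact_mod_cast hm
    have hδQ : (δ : ℚ) = 1 ∨ (δ : ℚ) = -1 := by exact_mod_cast hδ
    simp only [List.forall_mem_cons]
    refine ⟨?_, ?_, ?_, ?_, ?_, ?_, one_ne_zero, by simp⟩ <;> apply ne_of_gt <;>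
      rcases hδQ with h | h <;> nlinarith
  · have e1 : (2 * (k + 2) - 4) / 2 = k := by omega
    have e2 : (2 * (k + 2) - 2) / 2 = k + 1 := by omega
    have e3 : 2 * (k + 2) - 2 = 2 * (k + 1) := by omega
    have hmQ : (2 : ℚ) ^ k = m := by rw [hm_def]; push_cast; rfl
    have p2 : (2 : ℚ) ^ (k + 1) = 2 * m := by rw [← hmQ]; ring
    have p3 : (2 : ℚ) ^ (2 * (k + 1)) = 4 * m ^ 2 := by rw [← hmQ]; ring
    have p4 : (2 : ℚ) ^ (2 * (k + 2)) = 16 * m ^ 2 := by rw [← hmQ]; ring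
    have hνQ : (ν : ℚ) = 2 * (4 * m ^ 2 + δ * m) := by exact_mod_cast hνδ
    have hν0 : (ν : ℚ) ≠ 0 := by exact_mod_cast (show ν ≠ 0 by omega)
    have hν1 : (ν : ℚ) - 1 ≠ 0 := sub_ne_zero.2 (by exact_mod_cast (show ν ≠ 1 by omega))
    rw [e1, e2, e3, hmQ, p2, p3, p4]
    -- The denominators cancel after substituting ν = 2(4m² + δm); splitting on δ = ±1 supplies δ² =
    -- 1.
    have c1 : ((ν : ℚ) - 2 * m) * (ν - 2 * m - 2) / (4 * ν * (ν - 1)) * (16 * m ^ 2 - 1) =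
        (8 * m ^ 2 - 1 - (4 * m - δ)) / 2 := by
      rw [div_mul_eq_mul_div, div_eq_iff (mul_ne_zero (mul_ne_zero (by norm_num) hν0) hν1), hνQ]
      rcases hδ with rfl | rfl <;> push_cast <;> ring
    have c2 : ((ν : ℚ) ^ 2 - 4 * m ^ 2) / (2 * ν * (ν - 1)) * (16 * m ^ 2 - 1) = 8 * m ^ 2 := by
      rw [div_mul_eq_mul_div, div_eq_iff (mul_ne_zero (mul_ne_zero (by norm_num) hν0) hν1), hνQ]
      rcases hδ with rfl | rfl <;> push_cast <;> ring
    have c3 : ((ν : ℚ) + 2 * m) * (ν + 2 * m - 2) / (4 * ν * (ν - 1)) * (16 * m ^ 2 - 1) =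
        (8 * m ^ 2 - 1 + (4 * m - δ)) / 2 := by
      rw [div_mul_eq_mul_div, div_eq_iff (mul_ne_zero (mul_ne_zero (by norm_num) hν0) hν1), hνQ]
      rcases hδ with rfl | rfl <;> push_cast <;> ring
    have hνgQ : (ν : ℚ) = 2 * (g + m + 2) := by exact_mod_cast hνg
    rw [c1, c2, c3, show (ν : ℚ) / 2 - m - 2 = g by rw [hνgQ]; ring,
      show (ν : ℚ) / 2 - m - 1 = g + 1 by rw [hνgQ]; ring,
      show (ν : ℚ) / 2 - m = g + 2 by rw [hνgQ]; ring,
      show (ν : ℚ) / 2 + m - 2 = g + 2 * m by rw [hνgQ]; ring,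
      show (ν : ℚ) / 2 + m - 1 = g + 2 * m + 1 by rw [hνgQ]; ring,
      show (ν : ℚ) / 2 + m = g + 2 * m + 2 by rw [hνgQ]; ring,
      show (ν : ℚ) - 2 = 2 * g + 2 * m + 2 by rw [hνgQ]; ring]
    exact hdist
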